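/- Let $I=[0,1]$, let $\mathbb{N}=\{1,2,\dots\}$, and let $\overline{B}_r(c)$ denote the closed ball of radius $r$ about $c$ in $\mathbb{R}^3$ for the maximum metric. For a closed cube $C=\overline{B}_r(c)$ with $r>0$, let $a_C(x)=2r\left(x-(\tfrac12,\tfrac12,\tfrac12)\right)+c$ be the natural affine map from $I^3$ onto $C$. Let $E\subset[\tfrac14,\tfrac34]^2\times\{\tfrac12\}$ be a continuum (a non-empty compact connected set), and let $D=\{d_k:k\in\mathbb{N}\}$ be a dense subset of $E$ with a fixed enumeration (repetitions allowed). Put $$F_k^{E,D}=\overline{B}_{2^{-2k-1}}\left(d_k+(0,0,2^{-2k})\right)\quad(k\in\mathbb{N}),\qquad C_{E,D}=E\cup\bigcup_{k\in\mathbb{N}}F_k^{E,D}.$$ Let $X_1=C_{E,D}$ and $F_{\langle k\rangle}=F_k^{E,D}$ for $k\in\mathbb{N}$, and recursively, for $n\ge1$, $$X_{n+1}=\Big(X_n\setminus\bigcup_{f\in\mathbb{N}^n}F_f\Big)\cup\bigcup_{f\in\mathbb{N}^n}a_{F_f}(C_{E,D}),\qquad F_{f^\frown k}=a_{F_f}(F_k^{E,D})\quad(f\in\mathbb{N}^n,\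 k\in\mathbb{N}).$$ Then the subspace $X=\bigcap_{n\ge1}X_n$ of $\mathbb{R}^3$ is compact and metrizable; it is $h$-homogeneous, i.e. every non-empty clopen subset of $X$ is homeomorphic to $X$; and it is non-reconstructible, i.e. there is a topological space $Z$ that is not homeomorphic to $X$ but has the same cards as $X$, where a card of a space $Y$ is any space homeomorphic to $Y\setminus\{y\}$ for some $y\in Y$. -/

import Mathlib

namespace Reconstr

/-- `Y` is a card of `X`: it is homeomorphic to `X \ {x}` for some point `x` of `X`. -/
def IsCard (Y X : Type*) [TopologicalSpace Y] [TopologicalSpace X] : Prop :=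
  ∃ x : X, Nonempty (Y ≃ₜ ({x}ᶜ : Set X))

/-- `Z` is a reconstruction of `X`: both spaces have the same cards, that is, the same deck. -/
def IsReconstruction.{u} (Z X : Type u) [TopologicalSpace Z] [TopologicalSpace X] : Prop :=
  ∀ (Y : Type u) [TopologicalSpace Y], IsCard Y Z ↔ IsCard Y X

/-- `X` is (topologically) reconstructible: every space with the same deck as `X`
is homeomorphic to `X`. -/
def Reconstructible.{u} (X : Type u) [TopologicalSpace X] : Prop :=
  ∀ (Z : Type u) [TopologicalSpace Z], IsReconstruction Z X → Nonempty (Z ≃ₜ X)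

/-- `X` is h-homogeneous: every non-empty clopen subset is homeomorphic to `X`. -/
def HHomogeneous (X : Type*) [TopologicalSpace X] : Prop :=
  ∀ U : Set X, IsClopen U → U.Nonempty → Nonempty (U ≃ₜ X)

/-- `ℝ³`; the distance of `Fin 3 → ℝ` is the maximum distance. -/
abbrev R3 : Type := Fin 3 → ℝ

/-- The centre `(1/2, 1/2, 1/2)` of the unit cube. -/
noncomputable def mid : R3 := fun _ => 1 / 2

/-- The square `[1/4, 3/4]² × {1/2}` which contains the planar continua. -/
def baseSquare : Set R3 :=
  {x | x 0 ∈ Set.Icc (1 / 4 : ℝ) (3 / 4) ∧ x 1 ∈ Set.Icc (1 / 4 : ℝ) (3 / 4) ∧ x 2 = 1 / 2}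

/-- A closed axis-parallel cube in `ℝ³`, given by its centre and half its side-length. -/
structure Cube where
  center : R3
  radius : ℝ
  radius_pos : 0 < radius

namespace Cube

/-- The set of points of a cube: a closed ball for the maximum metric. -/
def toSet (C : Cube) : Set R3 := Metric.closedBall C.center C.radius

/-- The natural affine map `a_C` from the unit cube to `C`. -/
noncomputable def map (C : Cube) (x : R3) : R3 := (2 * C.radius) • (x - mid) + C.center

/-- The relativization `A|C` of a set `A` to the cube `C`. -/
def rel (C : Cube) (A : Set R3) : Set R3 := C.map '' A

/-- The unit cube `I³`. -/
noncomputable def unit : Cube := ⟨mid, 1 / 2, by norm_num⟩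

/-- The relativization of the cube `B` to the cube `C`, again as a cube (see `toSet_relCube`). -/
noncomputable def relCube (C B : Cube) : Cube :=
  ⟨C.map B.center, 2 * C.radius * B.radius,
    mul_pos (mul_pos two_pos C.radius_pos) B.radius_pos⟩

theorem toSet_relCube (C B : Cube) : (C.relCube B).toSet = C.rel B.toSet := by
  have hr : (0 : ℝ) < 2 * C.radius := mul_pos two_pos C.radius_pos
  have key : ∀ x y : R3, dist (C.map x) (C.map y) = 2 * C.radius * dist x y := by
    intro x y
    simp only [map, dist_add_right, dist_smul₀, dist_sub_right, Real.norm_eq_abs, abs_of_pos hr]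
  ext y
  simp only [toSet, rel, relCube, Metric.mem_closedBall, Set.mem_image]
  constructor
  · intro hy
    have hy' : C.map ((2 * C.radius)⁻¹ • (y - C.center) + mid) = y := by
      simp only [map, add_sub_cancel_right, smul_smul, mul_inv_cancel₀ hr.ne', one_smul,
        sub_add_cancel]
    refine ⟨(2 * C.radius)⁻¹ • (y - C.center) + mid, ?_, hy'⟩
    rw [← hy', key] at hy
    exact le_of_mul_le_mul_left hy hr
  · rintro ⟨x, hx, rfl⟩
    rw [key]
    exact mul_le_mul_of_nonneg_left hx hr.le

end Cube

/-- The cube `F_k` of a building block (`k = 1, 2, …`): the closed ball of radius `2^(-2k-1)`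
about `d_k + (0, 0, 2^(-2k))`. -/
noncomputable def blockCube (d : ℕ+ → R3) (k : ℕ+) : Cube :=
  ⟨d k + ![0, 0, (1 / 2) ^ (2 * (k : ℕ))], (1 / 2) ^ (2 * (k : ℕ) + 1), by positivity⟩

/-- The basic building block `C_{E,D} = E ∪ ⋃ₖ F_k`, where `d` enumerates `D`. -/
def block (E : Set R3) (d : ℕ+ → R3) : Set R3 := E ∪ ⋃ k, (blockCube d k).toSet

/-- The cubes `F_f` of the recursive construction. A finite sequence `f = (f₁, …, fₙ)` is
represented by the list `[fₙ, …, f₁]`, so that `k :: f` stands for `f` extended at its end by `k`.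
The cube of the empty sequence is `I³`. -/
noncomputable def cube (d : List ℕ+ → ℕ+ → R3) : List ℕ+ → Cube
  | [] => Cube.unit
  | k :: f => (cube d f).relCube (blockCube (d f) k)

/-- The stages of the recursive construction on the input `(E_f, D_f)_f`, where `d f` enumerates
`D_f`: `stage E d n` is `X_{n+1}`. -/
def stage (E : List ℕ+ → Set R3) (d : List ℕ+ → ℕ+ → R3) : ℕ → Set R3
  | 0 => Cube.unit.rel (block (E []) (d []))
  | n + 1 =>
      (stage E d n \ ⋃ f ∈ {f : List ℕ+ | f.length = n + 1}, (cube d f).toSet) ∪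
        ⋃ f ∈ {f : List ℕ+ | f.length = n + 1}, (cube d f).rel (block (E f) (d f))

/-- The space `X_ℰ`, the intersection of all stages, as a subset of `ℝ³`. -/
def limitSet (E : List ℕ+ → Set R3) (d : List ℕ+ → ℕ+ → R3) : Set R3 := ⋂ n, stage E d n

end Reconstr

/-!
Let `X` be the limit set. The recursion refines the smallest cubes at each stage, but it agrees with
the recursion that substitutes the previous stage into every cube of the building block
(`stage_succ`). Hence `X` is the disjoint union of `E` and the images `φ n (X)` of `X` under
contractions, one in each cube (`blockWith_limitSet`). These images are open in `X`, their diameters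
tend to zero, and by density of `D` they accumulate at every point of `E`. This is recorded as
`IsClopenSystem`; the remaining argument uses nothing else.

h-homogeneity. A clopen set `V` that contains `E` contains almost all images, and a subsequence of
them converges to a point of `E`. If `W` is a clopen copy of `X` disjoint from `V`, shifting the
sequence of `W` and these images by one place shows `V ∪ W ≃ₜ V` (`exists_shift`,
`nonempty_homeomorph_union`). Removing finitely many images from `X` therefore gives a copy of `X`,
and two disjoint clopen copies of `X` together form a copy of `X`. A clopen set either contains `E`
and almost all images or misses `E` and almost all images, because `E` is connected. So a clopen set
whose traces on the images are copies of `X` or empty is itself a copy of `X` or empty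
(`nonempty_homeomorph_of_inter_range`). The trace on an image, pulled back to `X`, is a clopen set
that separates points only at twice the distance; after finitely many pull-backs nothing is
separated any more, and the pulled-back set is empty or all of `X`.

Non-reconstructibility. Small clopen sets exist near every point and no point is isolated, so every
`x` is the limit of disjoint non-empty clopen sets, which are copies of `X` by h-homogeneity. So
`X \ {x}` splits off `ℕ × X`, and since two copies of `ℕ × X` form one, `X \ {x}` is homeomorphic to
`(X \ {x}) ⊕ (ℕ × X)`, which is `ℕ × X` with the point `(n, x)` removed. Thus `ℕ × X`, which is not
compact, has the same cards as `X`.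
-/

open Set Filter Topology

namespace Reconstr

/-! ### Shifting a convergent sequence of clopen sets -/

section Shift

variable {X : Type*} [TopologicalSpace X]

/-- A sequence of clopen sets converging to `x` has no accumulation points besides `x`. -/
theorem isClosed_insert_iUnion_of_converge [T2Space X] {B : ℕ → Set X}
    (hB : ∀ n, IsClopen (B n)) {x : X}
    (hlim : ∀ W ∈ 𝓝 x, ∃ N, ∀ n ≥ N, B n ⊆ W) : IsClosed (insert x (⋃ n, B n)) := by
  rw [← isOpen_compl_iff, isOpen_iff_mem_nhds]
  intro y hy
  simp only [mem_compl_iff, mem_insert_iff, mem_iUnion, not_or, not_exists] at hy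
  obtain ⟨U, V, hU, hV, hyU, hxV, hUV⟩ := t2_separation hy.1
  obtain ⟨N, hN⟩ := hlim V (hV.mem_nhds hxV)
  have h1 : ⋂ n ∈ Iio N, (B n)ᶜ ∈ 𝓝 y :=
    (biInter_mem (finite_Iio N)).2 fun n _ => (hB n).compl.isOpen.mem_nhds (hy.2 n)
  filter_upwards [h1, hU.mem_nhds hyU, isOpen_compl_singleton.mem_nhds hy.1] with z hz hzU hzx
  simp only [mem_compl_iff, mem_insert_iff, mem_iUnion, not_or, not_exists]
  refine ⟨hzx, fun n hn => ?_⟩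
  rcases lt_or_ge n N with h | h
  · exact mem_iInter₂.1 hz n h hn
  · exact disjoint_left.1 hUV hzU (hN n h hn)

/-- Moving each term of a convergent sequence of homeomorphic clopen sets onto the next term, and
fixing all other points, embeds a compact Hausdorff space onto the complement of the first term. -/
theorem exists_shift [CompactSpace X] [T2Space X] {B : ℕ → Set X}
    (hB : ∀ n, IsClopen (B n)) (hd : ∀ m n, m ≠ n → Disjoint (B m) (B n)) {x : X}
    (hx : ∀ n, x ∉ B n) (hlim : ∀ W ∈ 𝓝 x, ∃ N, ∀ n ≥ N, B n ⊆ W)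
    (h : ∀ n, Nonempty (B n ≃ₜ B (n + 1))) :
    ∃ f : X → X, IsClosedEmbedding f ∧ ∀ V, (∀ n, B n ⊆ V) → f '' V = V \ B 0 := by
  classical
  have e : ∀ n, B n ≃ₜ B (n + 1) := fun n => (h n).some
  let f : X → X := fun y => if hy : ∃ n, y ∈ B n then e hy.choose ⟨y, hy.choose_spec⟩ else y
  have uniq : ∀ {m n y}, y ∈ B m → y ∈ B n → m = n := fun {m n y} hm hn => by
    by_contra hne
    exact disjoint_left.1 (hd m n hne) hm hn
  have f_mem : ∀ n y (hy : y ∈ B n), f y = e n ⟨y, hy⟩ := by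
    intro n y hy
    have hex : ∃ n, y ∈ B n := ⟨n, hy⟩
    obtain rfl : n = hex.choose := uniq hy hex.choose_spec
    exact dif_pos hex
  have f_not : ∀ y, (∀ n, y ∉ B n) → f y = y := fun y hy => dif_neg (not_exists.2 hy)
  have f_B : ∀ n y, y ∈ B n → f y ∈ B (n + 1) := fun n y hy => by
    rw [f_mem n y hy]; exact Subtype.mem _
  have hcont : Continuous f := by
    rw [continuous_iff_continuousAt]
    intro y
    by_cases hy : ∃ n, y ∈ B n
    · obtain ⟨n, hn⟩ := hy
      refine ContinuousOn.continuousAt (s := B n) ?_ ((hB n).isOpen.mem_nhds hn)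
      rw [continuousOn_iff_continuous_domRestrict]
      have : (B n).domRestrict f = fun z => (e n z : X) := by
        ext z; exact f_mem n z z.2
      rw [this]
      exact continuous_subtype_val.comp (e n).continuous
    · push Not at hy
      by_cases hyx : y = x
      · subst hyx
        intro W hW
        rw [f_not y hy] at hW
        rw [mem_map]
        obtain ⟨N, hN⟩ := hlim W hW
        have h1 : ⋂ n ∈ Iio N, (B n)ᶜ ∈ 𝓝 y :=
          (biInter_mem (finite_Iio N)).2 fun n _ => (hB n).compl.isOpen.mem_nhds (hy n)
        filter_upwards [h1, hW] with z hz hzW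
        by_cases hzB : ∃ n, z ∈ B n
        · obtain ⟨n, hn⟩ := hzB
          have : N ≤ n := not_lt.1 fun hlt => mem_iInter₂.1 hz n hlt hn
          exact hN (n + 1) (by omega) (f_B n z hn)
        · push Not at hzB
          rw [mem_preimage, f_not z hzB]; exact hzW
      · have hcl := isClosed_insert_iUnion_of_converge hB hlim
        have hmem : y ∉ insert x (⋃ n, B n) := by
          simp only [mem_insert_iff, mem_iUnion, not_or, not_exists]
          exact ⟨hyx, hy⟩
        have : f =ᶠ[𝓝 y] id := by
          filter_upwards [hcl.isOpen_compl.mem_nhds hmem] with z hz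
          simp only [mem_compl_iff, mem_insert_iff, mem_iUnion, not_or, not_exists] at hz
          exact f_not z hz.2
        exact continuousAt_id.congr this.symm
  have hinj : Function.Injective f := by
    intro y z hyz
    by_cases hy : ∃ n, y ∈ B n <;> by_cases hz : ∃ n, z ∈ B n
    · obtain ⟨m, hm⟩ := hy
      obtain ⟨n, hn⟩ := hz
      have hmn : m + 1 = n + 1 := uniq (f_B m y hm) (hyz ▸ f_B n z hn)
      obtain rfl : m = n := by omega
      rw [f_mem m y hm, f_mem m z hn] at hyz
      exact congrArg Subtype.val ((e m).injective (Subtype.ext hyz))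
    · obtain ⟨m, hm⟩ := hy
      push Not at hz
      rw [f_not z hz] at hyz
      exact absurd (hyz ▸ f_B m y hm) (hz (m + 1))
    · obtain ⟨m, hm⟩ := hz
      push Not at hy
      rw [f_not y hy] at hyz
      exact absurd (hyz ▸ f_B m z hm) (hy (m + 1))
    · push Not at hy hz
      rwa [f_not y hy, f_not z hz] at hyz
  refine ⟨f, hcont.isClosedEmbedding hinj, fun V hV => ?_⟩
  ext z
  constructor
  · rintro ⟨y, hy, rfl⟩
    by_cases hyB : ∃ n, y ∈ B n
    · obtain ⟨n, hn⟩ := hyB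
      exact ⟨hV _ (f_B n y hn), fun h0 => by have := uniq h0 (f_B n y hn); omega⟩
    · push Not at hyB
      rw [f_not y hyB]
      exact ⟨hy, hyB 0⟩
  · rintro ⟨hz, hz0⟩
    by_cases hzB : ∃ n, z ∈ B n
    · obtain ⟨n, hn⟩ := hzB
      obtain _ | n := n
      · exact absurd hn hz0
      · refine ⟨(e n).symm ⟨z, hn⟩, hV n (Subtype.mem _), ?_⟩
        rw [f_mem n _ (Subtype.mem _)]
        simp
    · push Not at hzB
      exact ⟨z, hz, f_not z hzB⟩

end Shift

/-! ### Topological sums -/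

section Sums

variable {X : Type*} [TopologicalSpace X]

/-- The union of two disjoint open sets is their topological sum. -/
theorem nonempty_homeomorph_sum_of_disjoint {U V : Set X} (hU : IsOpen U) (hV : IsOpen V)
    (h : Disjoint U V) : Nonempty (U ⊕ V ≃ₜ ↥(U ∪ V)) := by
  let g : U ⊕ V → ↥(U ∪ V) := Sum.elim (inclusion subset_union_left) (inclusion subset_union_right)
  have hc : Continuous g :=
    (continuous_inclusion _).sumElim (continuous_inclusion _)
  have ho : IsOpenMap g := by
    rw [isOpenMap_sum]
    exact ⟨hU.isOpenMap_inclusion subset_union_left, hV.isOpenMap_inclusion subset_union_right⟩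
  have hb : Function.Bijective g := by
    constructor
    · rintro (a | a) (b | b) hab
      · exact congrArg Sum.inl (inclusion_injective subset_union_left hab)
      · exact absurd (congrArg Subtype.val hab) fun h' => disjoint_left.1 h a.2 (h' ▸ b.2)
      · exact absurd (congrArg Subtype.val hab) fun h' => disjoint_left.1 h b.2 (h' ▸ a.2)
      · exact congrArg Sum.inr (inclusion_injective subset_union_right hab)
    · rintro ⟨a, ha | ha⟩
      · exact ⟨Sum.inl ⟨a, ha⟩, rfl⟩
      · exact ⟨Sum.inr ⟨a, ha⟩, rfl⟩
  exact ⟨(Equiv.ofBijective g hb).toHomeomorphOfContinuousOpen hc ho⟩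

theorem isOpenMap_of_slices {ι Y : Type*} [TopologicalSpace ι] [TopologicalSpace Y]
    {g : ι × X → Y} (h : ∀ i, IsOpenMap fun x => g (i, x)) : IsOpenMap g := by
  intro U hU
  have : g '' U = ⋃ i, (fun x => g (i, x)) '' {x | (i, x) ∈ U} := by
    ext y
    simp only [mem_image, mem_iUnion, Prod.exists, mem_ofPred_eq]
  rw [this]
  exact isOpen_iUnion fun i => h i _ (hU.preimage (Continuous.prodMk_right i))

theorem nonempty_homeomorph_sum_nat_prod_self :
    Nonempty ((ℕ × X) ⊕ (ℕ × X) ≃ₜ ℕ × X) := by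
  let e : ℕ ⊕ ℕ ≃ₜ ℕ := Equiv.natSumNatEquivNat.toHomeomorphOfDiscrete
  exact ⟨Homeomorph.sumProdDistrib.symm.trans (e.prodCongr (Homeomorph.refl X))⟩

/-- Removing a point from one copy of `X` among countably many leaves a punctured copy and
countably many others. -/
theorem nonempty_homeomorph_compl_singleton_nat_prod [T1Space X] (n : ℕ) (x : X) :
    Nonempty (({x}ᶜ : Set X) ⊕ (ℕ × X) ≃ₜ ({(n, x)}ᶜ : Set (ℕ × X))) := by
  have : Infinite ({n}ᶜ : Set ℕ) := (finite_singleton n).infinite_compl.to_subtype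
  obtain ⟨_⟩ := nonempty_denumerable ({n}ᶜ : Set ℕ)
  let e : ({n}ᶜ : Set ℕ) ≃ ℕ := Denumerable.eqv _
  let g : ({x}ᶜ : Set X) ⊕ (ℕ × X) → ({(n, x)}ᶜ : Set (ℕ × X)) :=
    Sum.elim (fun y => ⟨(n, y), fun h => y.2 (congrArg Prod.snd h)⟩)
      fun p => ⟨(e.symm p.1, p.2), fun h => (e.symm p.1).2 (congrArg Prod.fst h)⟩
  have hc : Continuous g := by
    refine Continuous.sumElim (by fun_prop) ?_
    rw [continuous_prod_of_discrete_left]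
    exact fun m => by fun_prop
  have hslice : ∀ m : ℕ, IsOpenMap fun y : X => (m, y) := fun m U hU => by
    rw [← singleton_prod]
    exact (isOpen_discrete _).prod hU
  have ho : IsOpenMap g := by
    rw [isOpenMap_sum]
    constructor
    · exact ((hslice n).comp isOpen_compl_singleton.isOpenMap_subtype_val).subtype_mk _
    · exact isOpenMap_of_slices fun m => (hslice (e.symm m)).subtype_mk _
  have hb : Function.Bijective g := by
    constructor
    · rintro (a | ⟨l, a⟩) (b | ⟨m, b⟩) hab
      · have hv : (n, (a : X)) = (n, (b : X)) := congrArg Subtype.val hab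
        exact congrArg Sum.inl (Subtype.ext (congrArg Prod.snd hv))
      · have hv : (n, (a : X)) = ((e.symm m : ℕ), b) := congrArg Subtype.val hab
        exact absurd (congrArg Prod.fst hv).symm (e.symm m).2
      · have hv : ((e.symm l : ℕ), a) = (n, (b : X)) := congrArg Subtype.val hab
        exact absurd (congrArg Prod.fst hv) (e.symm l).2
      · have hv : ((e.symm l : ℕ), a) = ((e.symm m : ℕ), b) := congrArg Subtype.val hab
        obtain rfl : l = m := e.symm.injective (Subtype.ext (congrArg Prod.fst hv))
        obtain rfl : a = b := congrArg Prod.snd hv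
        rfl
    · rintro ⟨⟨m, a⟩, ha⟩
      by_cases hm : m = n
      · subst hm
        exact ⟨Sum.inl ⟨a, fun h => ha (by rw [mem_singleton_iff.1 h]; rfl)⟩, rfl⟩
      · exact ⟨Sum.inr (e ⟨m, hm⟩, a), Subtype.ext (by simp [g])⟩
  exact ⟨(Equiv.ofBijective g hb).toHomeomorphOfContinuousOpen hc ho⟩

/-- If `x` is the limit of a sequence of disjoint clopen copies of `X`, then `X \ {x}` splits off
countably many copies of `X`. -/
theorem exists_homeomorph_compl_singleton_sum [T2Space X] {B : ℕ → Set X}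
    (hB : ∀ n, IsClopen (B n)) (hd : ∀ m n, m ≠ n → Disjoint (B m) (B n)) {x : X}
    (hx : ∀ n, x ∉ B n) (hlim : ∀ W ∈ 𝓝 x, ∃ N, ∀ n ≥ N, B n ⊆ W)
    (h : ∀ n, Nonempty (B n ≃ₜ X)) :
    ∃ R : Set X, Nonempty (R ⊕ (ℕ × X) ≃ₜ ({x}ᶜ : Set X)) := by
  have e : ∀ n, B n ≃ₜ X := fun n => (h n).some
  let R : Set X := (insert x (⋃ n, B n))ᶜ
  have hR : IsOpen R := (isClosed_insert_iUnion_of_converge hB hlim).isOpen_compl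
  have hRx : R ⊆ {x}ᶜ := compl_subset_compl.2 (singleton_subset_iff.2 (mem_insert _ _))
  have hBx : ∀ n, B n ⊆ {x}ᶜ := fun n y hy => by rintro rfl; exact hx n hy
  let g : R ⊕ (ℕ × X) → ({x}ᶜ : Set X) :=
    Sum.elim (inclusion hRx) fun p => inclusion (hBx p.1) ((e p.1).symm p.2)
  have hc : Continuous g := by
    refine (continuous_inclusion _).sumElim ?_
    rw [continuous_prod_of_discrete_left]
    exact fun n => (continuous_inclusion (hBx n)).comp (e n).symm.continuous
  have ho : IsOpenMap g := by
    rw [isOpenMap_sum]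
    exact ⟨hR.isOpenMap_inclusion hRx, isOpenMap_of_slices fun n =>
      ((hB n).isOpen.isOpenMap_inclusion (hBx n)).comp (e n).symm.isOpenMap⟩
  have hnot : ∀ (a : R) n, (a : X) ∉ B n := fun a n hn =>
    a.2 (mem_insert_of_mem _ (mem_iUnion_of_mem n hn))
  have hb : Function.Bijective g := by
    constructor
    · rintro (a | ⟨m, a⟩) (b | ⟨n, b⟩) hab
      · exact congrArg Sum.inl (inclusion_injective hRx hab)
      · have hv : (a : X) = ((e n).symm b : B n) := congrArg Subtype.val hab
        exact absurd (hv ▸ Subtype.mem _) (hnot a n)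
      · have hv : (b : X) = ((e m).symm a : B m) := congrArg Subtype.val hab.symm
        exact absurd (hv ▸ Subtype.mem _) (hnot b m)
      · have hv : (((e m).symm a : B m) : X) = ((e n).symm b : B n) := congrArg Subtype.val hab
        obtain rfl : m = n := by
          by_contra hne
          exact disjoint_left.1 (hd m n hne) ((e m).symm a).2 (hv ▸ ((e n).symm b).2)
        rw [(e m).symm.injective (Subtype.ext hv)]
    · rintro ⟨a, ha⟩
      by_cases haB : ∃ n, a ∈ B n
      · obtain ⟨n, hn⟩ := haB
        exact ⟨Sum.inr (n, e n ⟨a, hn⟩), Subtype.ext (by simp [g])⟩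
      · refine ⟨Sum.inl ⟨a, ?_⟩, rfl⟩
        simp only [R, mem_compl_iff, mem_insert_iff, mem_iUnion, not_or]
        exact ⟨ha, haB⟩
  exact ⟨R, ⟨(Equiv.ofBijective g hb).toHomeomorphOfContinuousOpen hc ho⟩⟩

end Sums

/-! ### Compact spaces with a sequence of clopen self-copies -/

section System

/-- A sequence of injective contractions `φ n : X → X` with pairwise disjoint open images whose
diameters tend to zero, such that the points outside all the images form a connected set (the core) and are limits
of points of the images. For the limit set of the construction, `φ n` is the natural map onto its
part in one cube of the first stage, and the core is the continuum. -/
structure IsClopenSystem {X : Type*} [MetricSpace X] (φ : ℕ → X → X) : Prop where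
  injective : ∀ n, Function.Injective (φ n)
  dist_le_half : ∀ n x y, 2 * dist (φ n x) (φ n y) ≤ dist x y
  shrink : ∀ ε > 0, ∃ N, ∀ n ≥ N, ∀ x y, dist (φ n x) (φ n y) < ε
  isOpen_range : ∀ n, IsOpen (range (φ n))
  disjoint : ∀ m n, m ≠ n → Disjoint (range (φ m)) (range (φ n))
  isPreconnected_core : IsPreconnected (⋃ n, range (φ n))ᶜ
  dense : Dense (⋃ n, range (φ n))

namespace IsClopenSystem

theorem continuous {X : Type*} [MetricSpace X] {φ : ℕ → X → X} (h : IsClopenSystem φ) (n : ℕ) :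
    Continuous (φ n) :=
  (LipschitzWith.of_dist_le_mul (K := 1) fun x y => by
    have := h.dist_le_half n x y
    have := dist_nonneg (x := φ n x) (y := φ n y)
    rw [NNReal.coe_one]; linarith).continuous

variable {X : Type*} [MetricSpace X] [CompactSpace X] {φ : ℕ → X → X}

theorem isClosedEmbedding (h : IsClopenSystem φ) (n : ℕ) : IsClosedEmbedding (φ n) :=
  (h.continuous n).isClosedEmbedding (h.injective n)

theorem isClopen_range (h : IsClopenSystem φ) (n : ℕ) : IsClopen (range (φ n)) :=
  ⟨(h.isClosedEmbedding n).isClosed_range, h.isOpen_range n⟩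

theorem isOpenEmbedding (h : IsClopenSystem φ) (n : ℕ) : IsOpenEmbedding (φ n) :=
  ⟨(h.isClosedEmbedding n).isEmbedding, h.isOpen_range n⟩

theorem isClopen_image (h : IsClopenSystem φ) (n : ℕ) {U : Set X} (hU : IsClopen U) :
    IsClopen (φ n '' U) :=
  ⟨(h.isClosedEmbedding n).isClosedMap _ hU.1, (h.isOpenEmbedding n).isOpenMap _ hU.2⟩

theorem nonempty_homeomorph_range (h : IsClopenSystem φ) (n : ℕ) :
    Nonempty (range (φ n) ≃ₜ X) :=
  ⟨(h.isClosedEmbedding n).isEmbedding.toHomeomorph.symm⟩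

/-- A closed set disjoint from the core meets only finitely many images, by compactness. -/
theorem exists_forall_disjoint (h : IsClopenSystem φ) {K : Set X} (hK : IsClosed K)
    (hcore : K ⊆ ⋃ n, range (φ n)) :
    ∃ t : Finset ℕ, K ⊆ ⋃ n ∈ t, range (φ n) ∧ ∀ n ∉ t, Disjoint K (range (φ n)) := by
  obtain ⟨t, ht⟩ := hK.isCompact.elim_finite_subcover _ h.isOpen_range hcore
  refine ⟨t, ht, fun n hn => disjoint_left.2 fun x hxK hxn => ?_⟩
  obtain ⟨m, hm, hxm⟩ := mem_iUnion₂.1 (ht hxK)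
  exact disjoint_left.1 (h.disjoint m n fun hmn => hn (hmn ▸ hm)) hxm hxn

/-- Some subsequence of the images converges to a point of the core. -/
theorem exists_converging (h : IsClopenSystem φ) [Nonempty X] :
    ∃ a ∈ (⋃ n, range (φ n))ᶜ, ∃ u : ℕ → ℕ, StrictMono u ∧
      ∀ W ∈ 𝓝 a, ∃ N, ∀ n ≥ N, range (φ (u n)) ⊆ W := by
  obtain ⟨x⟩ := ‹Nonempty X›
  obtain ⟨a, -, u, hu, ha⟩ := isCompact_univ.tendsto_subseq (x := fun n => φ n x) fun _ => mem_univ _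
  rw [Metric.tendsto_atTop] at ha
  have key : ∀ W ∈ 𝓝 a, ∃ N, ∀ n ≥ N, range (φ (u n)) ⊆ W := by
    intro W hW
    obtain ⟨ε, hε, hεW⟩ := Metric.mem_nhds_iff.1 hW
    obtain ⟨M, hM⟩ := ha (ε / 2) (half_pos hε)
    obtain ⟨N, hN⟩ := h.shrink (ε / 2) (half_pos hε)
    refine ⟨max M N, fun n hn => ?_⟩
    rintro _ ⟨y, rfl⟩
    have h1 := hM n (le_trans (le_max_left _ _) hn)
    have h2 := hN (u n) (le_trans (le_trans (le_max_right _ _) hn) (hu.id_le n)) y x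
    exact hεW ((dist_triangle _ _ _).trans_lt (by simp only [Function.comp] at h1; linarith))
  refine ⟨a, fun hmem => ?_, u, hu, key⟩
  obtain ⟨m, hm⟩ := mem_iUnion.1 hmem
  obtain ⟨N, hN⟩ := key _ ((h.isOpen_range m).mem_nhds hm)
  have hlt : u (max N m) < u (max N m + 1) := hu (Nat.lt_succ_self _)
  have hge : max N m ≤ u (max N m) := hu.id_le _
  have hne : m ≠ u (max N m + 1) := by
    have := le_max_right N m; omega
  exact disjoint_left.1 (h.disjoint _ _ hne) (hN (max N m + 1) (by have := le_max_left N m; omega)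
    (mem_range_self x)) (mem_range_self x)

/-- A clopen set containing the core absorbs a copy of `X`: shift the copy and a convergent sequence
of images, which all are copies of `X`, by one place. -/
theorem nonempty_homeomorph_union (h : IsClopenSystem φ) [Nonempty X] {V W : Set X}
    (hV : IsClopen V) (hcore : (⋃ n, range (φ n))ᶜ ⊆ V) (hW : IsClopen W) (hVW : Disjoint V W)
    (e : Nonempty (W ≃ₜ X)) : Nonempty (↥(V ∪ W) ≃ₜ V) := by
  obtain ⟨a, ha, u, hu, hlim⟩ := h.exists_converging
  obtain ⟨N, hN⟩ := hlim V (hV.isOpen.mem_nhds (hcore ha))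
  let B : ℕ → Set X := fun n => n.casesOn W fun n => range (φ (u (n + N)))
  have hBX : ∀ n, Nonempty (↥(B n) ≃ₜ X) := by
    rintro (_ | n)
    exacts [e, h.nonempty_homeomorph_range _]
  have hBV : ∀ n, B (n + 1) ⊆ V := fun n => hN _ (Nat.le_add_left _ _)
  obtain ⟨f, hf, himage⟩ := exists_shift (B := B) (x := a)
    (by rintro (_ | n); exacts [hW, h.isClopen_range _])
    (by
      rintro (_ | m) (_ | n) hmn
      · exact absurd rfl hmn
      · exact (hVW.mono_left (hBV n)).symm
      · exact hVW.mono_left (hBV m)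
      · exact h.disjoint _ _ (hu.injective.ne (by omega)))
    (by
      rintro (_ | n) hn
      · exact disjoint_left.1 hVW (hcore ha) hn
      · exact ha (mem_iUnion_of_mem _ hn))
    (by
      intro S hS
      obtain ⟨M, hM⟩ := hlim S hS
      refine ⟨M + 1, ?_⟩
      rintro (_ | n) hn
      · omega
      · exact hM _ (by omega))
    (fun n => ⟨(hBX n).some.trans (hBX (n + 1)).some.symm⟩)
  have hfV : f '' (V ∪ W) = V := by
    rw [himage]
    · change (V ∪ W) \ W = V
      rw [union_sdiff_right, hVW.sdiff_eq_left]
    · rintro (_ | n)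
      exacts [subset_union_right, (hBV n).trans subset_union_left]
  exact ⟨(hf.isEmbedding.homeomorphImage _).trans (Homeomorph.setCongr hfV)⟩

/-- Absorbing finitely many clopen sets, each of which is empty or a copy of `X` inside one
image. -/
theorem nonempty_homeomorph_union_biUnion (h : IsClopenSystem φ) [Nonempty X] {V : Set X}
    (hV : IsClopen V) (hcore : (⋃ n, range (φ n))ᶜ ⊆ V) (t : Finset ℕ) (A : ℕ → Set X)
    (hA : ∀ n, IsClopen (A n)) (hAsub : ∀ n, A n ⊆ range (φ n))
    (hVA : ∀ n ∈ t, Disjoint V (A n)) (e : ∀ n, (A n).Nonempty → Nonempty (A n ≃ₜ X)) :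
    Nonempty (↥(V ∪ ⋃ n ∈ t, A n) ≃ₜ V) := by
  induction t using Finset.induction_on with
  | empty => exact ⟨Homeomorph.setCongr (by simp)⟩
  | insert n s hn ih =>
    obtain ⟨i⟩ := ih fun m hm => hVA m (Finset.mem_insert_of_mem hm)
    have heq : V ∪ ⋃ m ∈ insert n s, A m = (V ∪ ⋃ m ∈ s, A m) ∪ A n := by
      rw [Finset.set_biUnion_insert, union_assoc, union_comm (A n)]
    rcases (A n).eq_empty_or_nonempty with h0 | h0
    · exact ⟨(Homeomorph.setCongr (by rw [heq, h0, union_empty])).trans i⟩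
    · obtain ⟨j⟩ := h.nonempty_homeomorph_union (V := V ∪ ⋃ m ∈ s, A m) (W := A n)
        (hV.union (s.finite_toSet.isClopen_biUnion fun m _ => hA m))
        (hcore.trans subset_union_left) (hA n)
        (disjoint_union_left.2 ⟨hVA n (Finset.mem_insert_self _ _),
          disjoint_iUnion₂_left.2 fun m hm =>
            (h.disjoint m n fun hmn => hn (hmn ▸ hm)).mono (hAsub m) (hAsub n)⟩) (e n h0)
      exact ⟨(Homeomorph.setCongr heq).trans (j.trans i)⟩

/-- A clopen set containing the core is a copy of `X` if its part in every image is empty or a copy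
of `X`. -/
theorem nonempty_homeomorph_of_core_subset (h : IsClopenSystem φ) [Nonempty X] {U : Set X}
    (hU : IsClopen U) (hcore : (⋃ n, range (φ n))ᶜ ⊆ U)
    (e : ∀ n, (U ∩ range (φ n)).Nonempty → Nonempty (↥(U ∩ range (φ n)) ≃ₜ X)) :
    Nonempty (U ≃ₜ X) := by
  obtain ⟨t, htU, ht⟩ := h.exists_forall_disjoint hU.compl.isClosed (compl_subset_comm.1 hcore)
  -- Both `U` and `X` arise from `V` by adding copies of `X`.
  let V : Set X := (⋃ n ∈ t, range (φ n))ᶜ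
  have hV : IsClopen V := (t.finite_toSet.isClopen_biUnion fun n _ => h.isClopen_range n).compl
  have hVcore : (⋃ n, range (φ n))ᶜ ⊆ V :=
    compl_subset_compl.2 (iUnion₂_subset fun n _ => subset_iUnion (fun n => range (φ n)) n)
  have hVr : ∀ n ∈ t, Disjoint V (range (φ n)) := fun n hn =>
    disjoint_left.2 fun x hx hxn => hx (mem_iUnion₂_of_mem hn hxn)
  obtain ⟨i⟩ := h.nonempty_homeomorph_union_biUnion hV hVcore t (fun n => U ∩ range (φ n))
    (fun n => hU.inter (h.isClopen_range n)) (fun n => inter_subset_right)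
    (fun n hn => (hVr n hn).mono_right inter_subset_right) e
  obtain ⟨j⟩ := h.nonempty_homeomorph_union_biUnion hV hVcore t (fun n => range (φ n))
    h.isClopen_range (fun n => Subset.rfl) hVr fun n _ => h.nonempty_homeomorph_range n
  have h1 : V ∪ ⋃ n ∈ t, U ∩ range (φ n) = U := by
    rw [← inter_iUnion₂, union_inter_distrib_left, compl_union_self, inter_univ, union_eq_right]
    exact compl_subset_comm.1 htU
  have h2 : V ∪ ⋃ n ∈ t, range (φ n) = univ := compl_union_self _
  exact ⟨(Homeomorph.setCongr h1.symm).trans (i.trans (j.symm.trans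
    ((Homeomorph.setCongr h2).trans (Homeomorph.Set.univ X))))⟩

/-- A copy of `X` absorbs a disjoint copy of `X`. -/
theorem nonempty_homeomorph_union_of_homeomorph (h : IsClopenSystem φ) [Nonempty X] {U W : Set X}
    (hU : IsClopen U) (hW : IsClopen W) (hUW : Disjoint U W) (eU : Nonempty (U ≃ₜ X))
    (eW : Nonempty (W ≃ₜ X)) : Nonempty (↥(U ∪ W) ≃ₜ X) := by
  have hR := h.isClopen_range 0
  obtain ⟨i⟩ := h.nonempty_homeomorph_union hR.compl
    (compl_subset_compl.2 (subset_iUnion (fun n => range (φ n)) 0)) hR disjoint_compl_left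
    (h.nonempty_homeomorph_range 0)
  obtain ⟨j⟩ := nonempty_homeomorph_sum_of_disjoint hR.compl.isOpen hR.isOpen disjoint_compl_left
  obtain ⟨k⟩ := nonempty_homeomorph_sum_of_disjoint hU.isOpen hW.isOpen hUW
  let l : ↥((range (φ 0))ᶜ ∪ range (φ 0)) ≃ₜ X :=
    (Homeomorph.setCongr (compl_union_self _)).trans (Homeomorph.Set.univ X)
  let c : ↥((range (φ 0))ᶜ) ≃ₜ X := i.symm.trans l
  exact ⟨k.symm.trans ((eU.some.trans c.symm).sumCongr
    (eW.some.trans (h.nonempty_homeomorph_range 0).some.symm) |>.trans (j.trans l))⟩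

theorem nonempty_homeomorph_biUnion (h : IsClopenSystem φ) [Nonempty X] (t : Finset ℕ)
    (A : ℕ → Set X) (hA : ∀ n, IsClopen (A n)) (hAsub : ∀ n, A n ⊆ range (φ n))
    (e : ∀ n, (A n).Nonempty → Nonempty (A n ≃ₜ X)) (hne : (⋃ n ∈ t, A n).Nonempty) :
    Nonempty (↥(⋃ n ∈ t, A n) ≃ₜ X) := by
  induction t using Finset.induction_on with
  | empty => simp at hne
  | insert n s hn ih =>
    have heq : ⋃ m ∈ insert n s, A m = (⋃ m ∈ s, A m) ∪ A n := by
      rw [Finset.set_biUnion_insert, union_comm]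
    rcases (A n).eq_empty_or_nonempty with h0 | h0
    · rw [h0, union_empty] at heq
      rw [heq] at hne ⊢
      exact ih hne
    · rcases (⋃ m ∈ s, A m).eq_empty_or_nonempty with h1 | h1
      · rw [heq, h1, empty_union]
        exact e n h0
      · rw [heq]
        exact h.nonempty_homeomorph_union_of_homeomorph
          (s.finite_toSet.isClopen_biUnion fun m _ => hA m) (hA n)
          (disjoint_iUnion₂_left.2 fun m hm =>
            (h.disjoint m n fun hmn => hn (hmn ▸ hm)).mono (hAsub m) (hAsub n)) (ih h1) (e n h0)

/-- A non-empty clopen set is a copy of `X` if its part in every image is empty or a copy of `X`. -/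
theorem nonempty_homeomorph_of_inter_range (h : IsClopenSystem φ) [Nonempty X] {U : Set X}
    (hU : IsClopen U) (hne : U.Nonempty)
    (e : ∀ n, (U ∩ range (φ n)).Nonempty → Nonempty (↥(U ∩ range (φ n)) ≃ₜ X)) :
    Nonempty (U ≃ₜ X) := by
  by_cases hcap : ((⋃ n, range (φ n))ᶜ ∩ U).Nonempty
  · exact h.nonempty_homeomorph_of_core_subset hU
      (h.isPreconnected_core.subset_isClopen hU hcap) e
  · have hsub : U ⊆ ⋃ n, range (φ n) := fun x hx => by
      by_contra hx'
      exact hcap ⟨x, hx', hx⟩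
    obtain ⟨t, htU, -⟩ := h.exists_forall_disjoint hU.isClosed hsub
    have heq : ⋃ n ∈ t, U ∩ range (φ n) = U := by
      rw [← inter_iUnion₂, inter_eq_left]
      exact htU
    obtain ⟨i⟩ := h.nonempty_homeomorph_biUnion t (fun n => U ∩ range (φ n))
      (fun n => hU.inter (h.isClopen_range n)) (fun n => inter_subset_right) e
      (by rw [heq]; exact hne)
    exact ⟨(Homeomorph.setCongr heq.symm).trans i⟩

/-- Induction on the scale at which `U` separates points: a clopen set which does not separate
points at distance less than `D / 2 ^ (n + 1)` pulls back under each `φ k` to one which does not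
separate points at distance less than `D / 2 ^ n`. -/
theorem nonempty_homeomorph_of_scale (h : IsClopenSystem φ) [Nonempty X] {D : ℝ}
    (hD : ∀ x y : X, dist x y < D) (n : ℕ) (U : Set X) (hU : IsClopen U) (hne : U.Nonempty)
    (hscale : ∀ x y, dist x y * 2 ^ n < D → x ∈ U → y ∈ U) : Nonempty (U ≃ₜ X) := by
  induction n generalizing U with
  | zero =>
    obtain ⟨x, hx⟩ := hne
    have : U = univ := eq_univ_of_forall fun y => hscale x y (by simpa using hD x y) hx
    rw [this]
    exact ⟨Homeomorph.Set.univ X⟩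
  | succ n ih =>
    refine h.nonempty_homeomorph_of_inter_range hU hne fun k hk => ?_
    rw [← image_preimage_eq_inter_range] at hk ⊢
    obtain ⟨i⟩ := ih (φ k ⁻¹' U) (hU.preimage (h.continuous k)) hk.of_image
      fun x y hxy hx => hscale (φ k x) (φ k y) (by
        have h1 := mul_le_mul_of_nonneg_right (h.dist_le_half k x y) (pow_nonneg zero_le_two n)
        rw [pow_succ]
        linarith) hx
    exact ⟨((h.isClosedEmbedding k).isEmbedding.homeomorphImage _).symm.trans i⟩

theorem exists_dist_lt (X : Type*) [MetricSpace X] [CompactSpace X] :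
    ∃ D : ℝ, 0 < D ∧ ∀ x y : X, dist x y < D :=
  ⟨Metric.diam (univ : Set X) + 1, by positivity, fun x y =>
    (Metric.dist_le_diam_of_mem isCompact_univ.isBounded (mem_univ x) (mem_univ y)).trans_lt
      (lt_add_one _)⟩

theorem hHomogeneous (h : IsClopenSystem φ) : HHomogeneous X := by
  intro U hU hne
  have : Nonempty X := ⟨hne.some⟩
  obtain ⟨D, -, hD⟩ := exists_dist_lt X
  obtain ⟨δ, hδ, hball⟩ := lebesgue_number_lemma_of_metric (s := (univ : Set X))
    (c := fun b : Bool => if b then U else Uᶜ) isCompact_univ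
    (by rintro (_ | _); exacts [hU.compl.isOpen, hU.isOpen])
    (fun x _ => mem_iUnion.2 (by
      by_cases hx : x ∈ U
      exacts [⟨true, hx⟩, ⟨false, hx⟩]))
  obtain ⟨n, hn⟩ := pow_unbounded_of_one_lt (D / δ) one_lt_two
  refine h.nonempty_homeomorph_of_scale hD n U hU hne fun x y hxy hx => ?_
  have hlt : dist y x < δ := by
    rw [div_lt_iff₀ hδ] at hn
    rw [dist_comm]
    by_contra hge
    have := mul_le_mul_of_nonneg_right (not_lt.1 hge) (pow_nonneg (zero_le_two (α := ℝ)) n)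
    linarith
  obtain ⟨_ | _, hb⟩ := hball x (mem_univ x)
  · exact absurd hx (hb (Metric.mem_ball_self hδ))
  · exact hb hlt

/-- Points lying in arbitrarily small clopen sets are dense. -/
theorem dense_small_clopen (h : IsClopenSystem φ) {D : ℝ} (hD : ∀ x y : X, dist x y < D) (n : ℕ) :
    Dense {z : X | ∃ V, IsClopen V ∧ z ∈ V ∧ ∀ p ∈ V, ∀ q ∈ V, dist p q * 2 ^ n < D} := by
  induction n with
  | zero =>
    have heq : {z : X | ∃ V, IsClopen V ∧ z ∈ V ∧ ∀ p ∈ V, ∀ q ∈ V, dist p q * 2 ^ 0 < D} = univ :=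
      eq_univ_of_forall fun z => ⟨univ, isClopen_univ, mem_univ z, fun p _ q _ => by
        simpa using hD p q⟩
    rw [heq]
    exact dense_univ
  | succ n ih =>
    refine Dense.of_closure (h.dense.mono (iUnion_subset fun k => ?_))
    rintro _ ⟨x, rfl⟩
    refine (image_closure_subset_closure_image (h.continuous k)).trans (closure_mono ?_)
      (mem_image_of_mem (φ k) (ih x))
    rintro _ ⟨z, ⟨V, hV, hzV, hVd⟩, rfl⟩
    refine ⟨φ k '' V, h.isClopen_image k hV, mem_image_of_mem _ hzV, ?_⟩
    rintro _ ⟨p, hp, rfl⟩ _ ⟨q, hq, rfl⟩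
    have h1 := mul_le_mul_of_nonneg_right (h.dist_le_half k p q) (pow_nonneg zero_le_two n)
    have h2 := hVd p hp q hq
    rw [pow_succ]
    linarith

theorem exists_isClopen_subset (h : IsClopenSystem φ) {W : Set X} (hW : IsOpen W)
    (hne : W.Nonempty) : ∃ V, IsClopen V ∧ V.Nonempty ∧ V ⊆ W := by
  obtain ⟨y, hy⟩ := hne
  obtain ⟨D, hD0, hD⟩ := exists_dist_lt X
  obtain ⟨ε, hε, hεW⟩ := Metric.isOpen_iff.1 hW y hy
  obtain ⟨n, hn⟩ := pow_unbounded_of_one_lt (D / (ε / 2)) one_lt_two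
  obtain ⟨z, hz, V, hV, hzV, hVd⟩ := (h.dense_small_clopen hD n).inter_open_nonempty
    (Metric.ball y (ε / 2)) Metric.isOpen_ball ⟨y, Metric.mem_ball_self (half_pos hε)⟩
  refine ⟨V, hV, ⟨z, hzV⟩, fun p hp => hεW ?_⟩
  have hlt : dist p z < ε / 2 := by
    have h1 := hVd p hp z hzV
    rw [div_lt_iff₀ (half_pos hε)] at hn
    by_contra hge
    have := mul_le_mul_of_nonneg_right (not_lt.1 hge) (pow_nonneg (zero_le_two (α := ℝ)) n)
    linarith
  have := Metric.mem_ball.1 hz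
  have := dist_triangle p z y
  exact Metric.mem_ball.2 (by linarith)

/-- There are no isolated points: an isolated point would be a clopen copy of `X`, but `X` has at
least two points. -/
theorem not_isOpen_singleton (h : IsClopenSystem φ) (x : X) : ¬ IsOpen ({x} : Set X) := by
  intro hx
  obtain ⟨e⟩ := h.hHomogeneous {x} ⟨isClosed_singleton, hx⟩ (singleton_nonempty x)
  have hsub : Subsingleton X := e.symm.injective.subsingleton
  have := Subsingleton.elim (φ 0 x) (φ 1 x)
  exact disjoint_left.1 (h.disjoint 0 1 zero_ne_one) (mem_range_self x) (this ▸ mem_range_self x)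

theorem exists_clopen_sequence (h : IsClopenSystem φ) (x : X) :
    ∃ B : ℕ → Set X, (∀ n, IsClopen (B n)) ∧ (∀ n, (B n).Nonempty) ∧
      (∀ m n, m ≠ n → Disjoint (B m) (B n)) ∧ (∀ n, x ∉ B n) ∧
      ∀ W ∈ 𝓝 x, ∃ N, ∀ n ≥ N, B n ⊆ W := by
  obtain ⟨f, hf, hr⟩ := exists_seq_of_forall_finset_exists
    (fun p : ℕ × Set X => IsClopen p.2 ∧ p.2.Nonempty ∧ x ∉ p.2 ∧
      p.2 ⊆ Metric.ball x (1 / (p.1 + 1)))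
    (fun p q => p.1 < q.1 ∧ Disjoint p.2 q.2) (by
      intro s hs
      let n := s.sup Prod.fst + 1
      have hpos : (0 : ℝ) < 1 / (n + 1) := by positivity
      have hcl : IsClosed (⋃ p ∈ s, p.2) :=
        s.finite_toSet.isClosed_biUnion fun p hp => (hs p hp).1.isClosed
      have hmem : Metric.ball x (1 / ((n : ℝ) + 1)) ∩ (⋃ p ∈ s, p.2)ᶜ ∈ 𝓝 x := by
        refine inter_mem (Metric.ball_mem_nhds x hpos) (hcl.isOpen_compl.mem_nhds ?_)
        simp only [mem_compl_iff, mem_iUnion, not_exists]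
        exact fun p hp => (hs p hp).2.2.1
      have hopen : IsOpen (Metric.ball x (1 / ((n : ℝ) + 1)) ∩ (⋃ p ∈ s, p.2)ᶜ) :=
        Metric.isOpen_ball.inter hcl.isOpen_compl
      have hne : ((Metric.ball x (1 / ((n : ℝ) + 1)) ∩ (⋃ p ∈ s, p.2)ᶜ) \ {x}).Nonempty := by
        rw [nonempty_iff_ne_empty, Ne, sdiff_eq_empty]
        intro hsub
        exact h.not_isOpen_singleton x
          ((hsub.antisymm (singleton_subset_iff.2 (mem_of_mem_nhds hmem))) ▸ hopen)
      obtain ⟨V, hV, hVne, hVsub⟩ := h.exists_isClopen_subset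
        (hopen.sdiff isClosed_singleton) hne
      -- The new index exceeds all earlier ones, so the radii along the sequence tend to zero.
      refine ⟨(n, V), ⟨hV, hVne, fun hxV => (hVsub hxV).2 rfl, fun y hy => (hVsub hy).1.1⟩,
        fun p hp => ⟨Nat.lt_succ_of_le (Finset.le_sup (f := Prod.fst) hp), ?_⟩⟩
      exact disjoint_left.2 fun y hyp hyV => (hVsub hyV).1.2 (mem_iUnion₂_of_mem hp hyp))
  have hmono : StrictMono fun n => (f n).1 := fun m n hmn => (hr m n hmn).1
  refine ⟨fun n => (f n).2, fun n => (hf n).1, fun n => (hf n).2.1, fun m n hmn => ?_,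
    fun n => (hf n).2.2.1, fun W hW => ?_⟩
  · rcases lt_or_gt_of_ne hmn with hlt | hlt
    · exact (hr m n hlt).2
    · exact (hr n m hlt).2.symm
  · obtain ⟨ε, hε, hεW⟩ := Metric.mem_nhds_iff.1 hW
    obtain ⟨N, hN⟩ := exists_nat_one_div_lt hε
    refine ⟨N, fun n hn => ((hf n).2.2.2.trans (Metric.ball_subset_ball ?_)).trans hεW⟩
    refine (one_div_le_one_div_of_le (by positivity) ?_).trans hN.le
    have : N ≤ (f n).1 := hn.trans (hmono.id_le n)
    exact_mod_cast Nat.succ_le_succ this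

/-- The space `ℕ × X` has the same cards as `X`, but it is not compact. -/
theorem not_reconstructible.{u} {X : Type u} [MetricSpace X] [CompactSpace X] [Nonempty X]
    {φ : ℕ → X → X} (h : IsClopenSystem φ) : ¬ Reconstructible X := by
  intro hrec
  have card : ∀ n x, Nonempty (({(n, x)}ᶜ : Set (ℕ × X)) ≃ₜ ({x}ᶜ : Set X)) := by
    intro n x
    obtain ⟨B, hB, hBne, hd, hx, hlim⟩ := h.exists_clopen_sequence x
    obtain ⟨R, ⟨i⟩⟩ := exists_homeomorph_compl_singleton_sum hB hd hx hlim
      fun n => h.hHomogeneous _ (hB n) (hBne n)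
    obtain ⟨j⟩ := nonempty_homeomorph_compl_singleton_nat_prod n x
    obtain ⟨k⟩ := nonempty_homeomorph_sum_nat_prod_self (X := X)
    exact ⟨j.symm.trans ((i.symm.sumCongr (Homeomorph.refl _)).trans
      ((Homeomorph.sumAssoc _ _ _).trans (((Homeomorph.refl _).sumCongr k).trans i)))⟩
  have hZ : IsReconstruction (ℕ × X) X := by
    intro Y _
    constructor
    · rintro ⟨⟨n, x⟩, ⟨e⟩⟩
      exact ⟨x, ⟨e.trans (card n x).some⟩⟩
    · rintro ⟨x, ⟨e⟩⟩
      exact ⟨(0, x), ⟨e.trans (card 0 x).some.symm⟩⟩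
  obtain ⟨e⟩ := hrec (ℕ × X) hZ
  have hcomp : CompactSpace (ℕ × X) := e.symm.compactSpace
  have hcompN : CompactSpace ℕ :=
    (Prod.fst_surjective (α := ℕ) (β := X)).compactSpace continuous_fst
  exact not_finite_iff_infinite.2 inferInstance (finite_of_compact_of_discrete (X := ℕ))

end IsClopenSystem

end System

/-! ### The cubes of the building block -/

section Cubes

namespace Cube

theorem dist_map (C : Cube) (x y : R3) : dist (C.map x) (C.map y) = 2 * C.radius * dist x y := by
  have hr : (0 : ℝ) < 2 * C.radius := mul_pos two_pos C.radius_pos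
  simp only [map, dist_add_right, dist_smul₀, dist_sub_right, Real.norm_eq_abs, abs_of_pos hr]

theorem map_injective (C : Cube) : Function.Injective C.map := fun x y hxy => by
  have h := C.dist_map x y
  rw [hxy, dist_self] at h
  have := (mul_eq_zero.1 h.symm).resolve_left (mul_pos two_pos C.radius_pos).ne'
  exact dist_eq_zero.1 this

theorem continuous_map (C : Cube) : Continuous C.map := by
  unfold map
  fun_prop

theorem map_relCube (C B : Cube) (x : R3) : (C.relCube B).map x = C.map (B.map x) := by
  ext i
  simp only [map, relCube, Pi.add_apply, Pi.smul_apply, Pi.sub_apply, smul_eq_mul]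
  ring

theorem unit_map (x : R3) : unit.map x = x := by
  ext i
  simp only [map, unit, Pi.add_apply, Pi.smul_apply, Pi.sub_apply, smul_eq_mul]
  ring

theorem unit_rel (A : Set R3) : unit.rel A = A := by
  have : unit.map = id := funext unit_map
  rw [rel, this, image_id]

theorem rel_unit (C : Cube) : C.map '' unit.toSet = C.toSet := by
  have h := toSet_relCube C unit
  rw [rel] at h
  rw [← h]
  have hc : (C.relCube unit).center = C.center := by
    simp [relCube, map, unit]
  have hr : (C.relCube unit).radius = C.radius := by
    simp only [relCube, unit]; ring
  rw [toSet, toSet, hc, hr]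

theorem rel_relCube (C B : Cube) (A : Set R3) : (C.relCube B).rel A = C.map '' B.rel A := by
  rw [rel, rel, image_image]
  exact image_congr fun x _ => map_relCube C B x

end Cube

theorem mem_blockCube_iff {d : ℕ+ → R3} {k : ℕ+} {y : R3} : y ∈ (blockCube d k).toSet ↔
    |y 0 - d k 0| ≤ (1 / 4) ^ (k : ℕ) / 2 ∧ |y 1 - d k 1| ≤ (1 / 4) ^ (k : ℕ) / 2 ∧
      |y 2 - (d k 2 + (1 / 4) ^ (k : ℕ))| ≤ (1 / 4) ^ (k : ℕ) / 2 := by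
  have h1 : ((1 : ℝ) / 2) ^ (2 * (k : ℕ)) = (1 / 4) ^ (k : ℕ) := by
    rw [pow_mul]; norm_num
  have h2 : ((1 : ℝ) / 2) ^ (2 * (k : ℕ) + 1) = (1 / 4) ^ (k : ℕ) / 2 := by
    rw [pow_succ, h1]; ring
  rw [Cube.toSet, Metric.mem_closedBall, blockCube]
  simp only [h1, h2]
  rw [dist_pi_le_iff (by positivity), Fin.forall_fin_succ, Fin.forall_fin_succ,
    Fin.forall_fin_succ]
  simp [Real.dist_eq]

theorem pow_quarter_le (k : ℕ+) : ((1 : ℝ) / 4) ^ (k : ℕ) ≤ 1 / 4 := by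
  have := pow_le_pow_of_le_one (by norm_num : (0 : ℝ) ≤ 1 / 4) (by norm_num) (Nat.succ_le_of_lt k.pos)
  rwa [Nat.succ_eq_add_one, zero_add, pow_one] at this

theorem pow_quarter_le_of_lt {j k : ℕ+} (h : j < k) :
    ((1 : ℝ) / 4) ^ (k : ℕ) ≤ (1 / 4) ^ (j : ℕ) / 4 := by
  have := pow_le_pow_of_le_one (by norm_num : (0 : ℝ) ≤ 1 / 4) (by norm_num)
    (Nat.succ_le_of_lt (PNat.coe_lt_coe _ _ |>.2 h))
  rw [Nat.succ_eq_add_one, pow_succ] at this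
  linarith

variable {E : Set R3} {d : ℕ+ → R3}

theorem two_mul_radius_blockCube (k : ℕ+) :
    2 * (blockCube d k).radius = (1 / 4) ^ (k : ℕ) := by
  simp only [blockCube]
  rw [pow_succ, pow_mul]
  ring_nf

theorem baseSquare_subset_unit : baseSquare ⊆ Cube.unit.toSet := by
  rintro x ⟨⟨h0, h0'⟩, ⟨h1, h1'⟩, h2⟩
  rw [Cube.toSet, Metric.mem_closedBall, Cube.unit]
  simp only
  rw [dist_pi_le_iff (by norm_num), Fin.forall_fin_succ, Fin.forall_fin_succ, Fin.forall_fin_succ]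
  simp only [Real.dist_eq, mid, Fin.succ_zero_eq_one, Fin.succ_one_eq_two, abs_le]
  refine ⟨⟨?_, ?_⟩, ⟨?_, ?_⟩, ⟨?_, ?_⟩, fun i => i.elim0⟩ <;> linarith

theorem blockCube_subset_unit {k : ℕ+} (hd : d k ∈ baseSquare) :
    (blockCube d k).toSet ⊆ Cube.unit.toSet := by
  intro x hx
  obtain ⟨h0, h1, h2⟩ := mem_blockCube_iff.1 hx
  obtain ⟨⟨e0, e0'⟩, ⟨e1, e1'⟩, e2⟩ := hd
  have hk := pow_quarter_le k
  rw [abs_le] at h0 h1 h2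
  rw [Cube.toSet, Metric.mem_closedBall, Cube.unit]
  simp only
  rw [dist_pi_le_iff (by norm_num), Fin.forall_fin_succ, Fin.forall_fin_succ, Fin.forall_fin_succ]
  simp only [Real.dist_eq, mid, Fin.succ_zero_eq_one, Fin.succ_one_eq_two, abs_le]
  refine ⟨⟨?_, ?_⟩, ⟨?_, ?_⟩, ⟨?_, ?_⟩, fun i => i.elim0⟩ <;> linarith

/-- The cubes lie strictly above the plane of the base square. -/
theorem disjoint_baseSquare_blockCube {k : ℕ+} (hd : d k ∈ baseSquare) :
    Disjoint baseSquare (blockCube d k).toSet := by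
  refine disjoint_left.2 fun x hx hxk => ?_
  have h2 := (mem_blockCube_iff.1 hxk).2.2
  rw [abs_le, hx.2.2, hd.2.2] at h2
  have : (0 : ℝ) < (1 / 4) ^ (k : ℕ) := by positivity
  linarith [h2.1]

/-- Different cubes are at different heights. -/
theorem disjoint_blockCube (hd : ∀ k, d k ∈ baseSquare) {j k : ℕ+} (hjk : j ≠ k) :
    Disjoint (blockCube d j).toSet (blockCube d k).toSet := by
  wlog hlt : j < k generalizing j k
  · exact (this hjk.symm (lt_of_le_of_ne (not_lt.1 hlt) hjk.symm)).symm
  refine disjoint_left.2 fun x hxj hxk => ?_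
  have hj := (mem_blockCube_iff.1 hxj).2.2
  have hk := (mem_blockCube_iff.1 hxk).2.2
  rw [abs_le, (hd _).2.2] at hj hk
  have : (0 : ℝ) < (1 / 4) ^ (j : ℕ) := by positivity
  have := pow_quarter_le_of_lt hlt
  linarith [hj.1, hk.2]

theorem dist_le_of_mem_blockCube {k : ℕ+} {x : R3} (hx : x ∈ (blockCube d k).toSet) :
    dist x (d k) ≤ 2 * (1 / 4) ^ (k : ℕ) := by
  obtain ⟨h0, h1, h2⟩ := mem_blockCube_iff.1 hx
  have hpos : (0 : ℝ) < (1 / 4) ^ (k : ℕ) := by positivity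
  rw [abs_le] at h0 h1 h2
  rw [dist_pi_le_iff (by positivity), Fin.forall_fin_succ, Fin.forall_fin_succ,
    Fin.forall_fin_succ]
  simp only [Real.dist_eq, Fin.succ_zero_eq_one, Fin.succ_one_eq_two, abs_le]
  refine ⟨⟨?_, ?_⟩, ⟨?_, ?_⟩, ⟨?_, ?_⟩, fun i => i.elim0⟩ <;> linarith

/-- The cubes accumulate only at `E`, so adding to `E` a closed subset of each cube gives a closed
set. -/
theorem isClosed_union_iUnion (hE : IsClosed E) (hdE : ∀ k, d k ∈ E) {A : ℕ+ → Set R3}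
    (hA : ∀ k, IsClosed (A k)) (hAd : ∀ k, A k ⊆ (blockCube d k).toSet) :
    IsClosed (E ∪ ⋃ k, A k) := by
  have hlim : Tendsto (fun n : ℕ => 2 * ((1 : ℝ) / 4) ^ n) atTop (𝓝 0) := by
    simpa using (tendsto_pow_atTop_nhds_zero_of_lt_one (by norm_num : (0 : ℝ) ≤ 1 / 4)
      (by norm_num)).const_mul 2
  have heq : E ∪ ⋃ k, A k =
      ⋂ n : ℕ, (Metric.cthickening (2 * (1 / 4) ^ n) E ∪ ⋃ k ∈ {k : ℕ+ | (k : ℕ) < n}, A k) := by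
    ext x
    simp only [mem_union, mem_iUnion, mem_iInter, mem_ofPred_eq, exists_prop]
    constructor
    · rintro (hx | ⟨k, hk⟩) n
      · exact Or.inl (Metric.self_subset_cthickening E hx)
      · rcases lt_or_ge (k : ℕ) n with h | h
        · exact Or.inr ⟨k, h, hk⟩
        · refine Or.inl (Metric.mem_cthickening_of_dist_le x (d k) _ E (hdE k)
            ((dist_le_of_mem_blockCube (hAd k hk)).trans ?_))
          have := pow_le_pow_of_le_one (by norm_num : (0 : ℝ) ≤ 1 / 4) (by norm_num) h
          linarith
    · intro hx
      by_contra hnot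
      rw [not_or, not_exists] at hnot
      refine hnot.1 ?_
      rw [← hE.closure_eq, Metric.closure_eq_iInter_cthickening, mem_iInter₂]
      intro δ hδ
      obtain ⟨n, hn⟩ := (hlim.eventually_lt_const hδ).exists
      rcases hx n with h | ⟨k, -, hk⟩
      · exact Metric.cthickening_mono hn.le E h
      · exact absurd hk (hnot.2 k)
  rw [heq]
  refine isClosed_iInter fun n => Metric.isClosed_cthickening.union ?_
  have hfin : {k : ℕ+ | (k : ℕ) < n}.Finite :=
    (finite_Iio n).preimage PNat.coe_injective.injOn
  exact hfin.isClosed_biUnion fun k _ => hA k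

end Cubes

/-! ### Self-similarity of the limit set -/

section Stages

variable {E : Set R3} {d : ℕ+ → R3}

/-- One step of the construction as an operation on sets: the building block with every cube
replaced by a scaled copy of `A`. -/
def blockWith (E : Set R3) (d : ℕ+ → R3) (A : Set R3) : Set R3 :=
  E ∪ ⋃ k, (blockCube d k).map '' A

theorem blockWith_unit : blockWith E d Cube.unit.toSet = block E d := by
  simp only [blockWith, block, Cube.rel_unit]

theorem image_subset_blockCube {A : Set R3} (hA : A ⊆ Cube.unit.toSet) (k : ℕ+) :
    (blockCube d k).map '' A ⊆ (blockCube d k).toSet := by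
  rw [← Cube.rel_unit]
  exact image_mono hA

theorem blockWith_subset_unit (hE : E ⊆ baseSquare) (hdE : ∀ k, d k ∈ E) {A : Set R3}
    (hA : A ⊆ Cube.unit.toSet) : blockWith E d A ⊆ Cube.unit.toSet :=
  union_subset (hE.trans baseSquare_subset_unit) (iUnion_subset fun k =>
    (image_subset_blockCube hA k).trans (blockCube_subset_unit (hE (hdE k))))

theorem isClosed_blockWith (hE : IsClosed E) (hdE : ∀ k, d k ∈ E) {A : Set R3}
    (hA : A ⊆ Cube.unit.toSet) (hcl : IsClosed A) : IsClosed (blockWith E d A) := by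
  have hcomp : IsCompact A :=
    (isCompact_closedBall Cube.unit.center Cube.unit.radius).of_isClosed_subset hcl hA
  exact isClosed_union_iUnion hE hdE
    (fun k => (hcomp.image (blockCube d k).continuous_map).isClosed)
    (image_subset_blockCube hA)

theorem eq_of_mem_blockCube (hE : E ⊆ baseSquare) (hdE : ∀ k, d k ∈ E) {j k : ℕ+} {x : R3}
    (hj : x ∈ (blockCube d j).toSet) (hk : x ∈ (blockCube d k).toSet) : j = k := by
  by_contra hne
  exact disjoint_left.1 (disjoint_blockCube (fun k => hE (hdE k)) hne) hj hk

theorem notMem_of_mem_blockCube (hE : E ⊆ baseSquare) (hdE : ∀ k, d k ∈ E) {k : ℕ+} {x : R3}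
    (hk : x ∈ (blockCube d k).toSet) : x ∉ E := fun hx =>
  disjoint_left.1 (disjoint_baseSquare_blockCube (hE (hdE k))) (hE hx) hk

theorem map_mem_blockCube {x : R3} (hx : x ∈ Cube.unit.toSet) (k : ℕ+) :
    (blockCube d k).map x ∈ (blockCube d k).toSet :=
  image_subset_blockCube Subset.rfl k (mem_image_of_mem _ hx)

theorem map_mem_blockWith_iff (hE : E ⊆ baseSquare) (hdE : ∀ k, d k ∈ E) {A : Set R3}
    (hA : A ⊆ Cube.unit.toSet) {x : R3} (hx : x ∈ Cube.unit.toSet) {k : ℕ+} :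
    (blockCube d k).map x ∈ blockWith E d A ↔ x ∈ A := by
  constructor
  · rintro (h | h)
    · exact absurd h (notMem_of_mem_blockCube hE hdE (map_mem_blockCube hx k))
    · obtain ⟨j, y, hy, hyx⟩ := mem_iUnion.1 h
      obtain rfl : j = k := eq_of_mem_blockCube hE hdE (map_mem_blockCube (hA hy) j)
        (hyx ▸ map_mem_blockCube hx k)
      rwa [← Cube.map_injective _ hyx]
  · exact fun h => Or.inr (mem_iUnion_of_mem k (mem_image_of_mem _ h))

theorem blockWith_diff_union (hE : E ⊆ baseSquare) (hdE : ∀ k, d k ∈ E) {S A C : Set R3}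
    (hS : S ⊆ Cube.unit.toSet) (hA : A ⊆ Cube.unit.toSet) :
    (blockWith E d S \ ⋃ k, (blockCube d k).map '' A) ∪ ⋃ k, (blockCube d k).map '' C =
      blockWith E d (S \ A ∪ C) := by
  have h : blockWith E d S \ ⋃ k, (blockCube d k).map '' A = blockWith E d (S \ A) := by
    ext x
    constructor
    · rintro ⟨h | h, hn⟩
      · exact Or.inl h
      · obtain ⟨k, y, hy, rfl⟩ := mem_iUnion.1 h
        exact Or.inr (mem_iUnion_of_mem k (mem_image_of_mem _
          ⟨hy, fun hyA => hn (mem_iUnion_of_mem k (mem_image_of_mem _ hyA))⟩))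
    · rintro (h | h)
      · refine ⟨Or.inl h, fun hx => ?_⟩
        obtain ⟨k, hk⟩ := mem_iUnion.1 hx
        exact notMem_of_mem_blockCube hE hdE (image_subset_blockCube hA k hk) h
      · obtain ⟨k, y, ⟨hy, hyA⟩, rfl⟩ := mem_iUnion.1 h
        refine ⟨Or.inr (mem_iUnion_of_mem k (mem_image_of_mem _ hy)), fun hx => hyA ?_⟩
        exact (map_mem_blockWith_iff hE hdE hA (hS hy)).1 (Or.inr hx)
  rw [h]
  simp only [blockWith, image_union, iUnion_union_distrib, union_assoc]

theorem cube_append_singleton (k : ℕ+) (f : List ℕ+) :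
    cube (fun _ => d) (f ++ [k]) = (blockCube d k).relCube (cube (fun _ => d) f) := by
  have ext : ∀ {B C : Cube}, B.center = C.center → B.radius = C.radius → B = C := by
    rintro ⟨b, r, hr⟩ ⟨c, s, hs⟩ rfl rfl
    rfl
  induction f with
  | nil =>
    refine ext ?_ ?_
    · simp [cube, Cube.relCube, Cube.unit_map]
      simp [Cube.map, Cube.unit]
    · simp only [List.nil_append, cube, Cube.relCube, Cube.unit]
      ring
  | cons j f ih =>
    rw [List.cons_append, cube, cube, ih]
    refine ext ?_ ?_
    · exact Cube.map_relCube _ _ _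
    · simp only [Cube.relCube]
      ring

/-- Words of length `n + 1` are sorted by their last entry, that is, by the cube of the first stage
which contains their cube. -/
theorem iUnion_length_succ (G : List ℕ+ → Set R3) (n : ℕ) :
    ⋃ f ∈ {f : List ℕ+ | f.length = n + 1}, G f =
      ⋃ k, ⋃ g ∈ {g : List ℕ+ | g.length = n}, G (g ++ [k]) := by
  ext x
  simp only [mem_iUnion, mem_ofPred_eq, exists_prop]
  constructor
  · rintro ⟨f, hf, hx⟩
    have hne : f ≠ [] := by rintro rfl; simp at hf
    refine ⟨f.getLast hne, f.dropLast, by simp [hf], ?_⟩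
    rwa [List.dropLast_append_getLast]
  · rintro ⟨k, g, hg, hx⟩
    exact ⟨g ++ [k], by simp [hg], hx⟩

theorem iUnion_cube_succ (n : ℕ) :
    ⋃ f ∈ {f : List ℕ+ | f.length = n + 1}, (cube (fun _ => d) f).toSet =
      ⋃ k, (blockCube d k).map '' ⋃ f ∈ {f : List ℕ+ | f.length = n},
        (cube (fun _ => d) f).toSet := by
  rw [iUnion_length_succ]
  simp only [cube_append_singleton, Cube.toSet_relCube, Cube.rel, image_iUnion]

theorem iUnion_rel_succ (A : Set R3) (n : ℕ) :
    ⋃ f ∈ {f : List ℕ+ | f.length = n + 1}, (cube (fun _ => d) f).rel A =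
      ⋃ k, (blockCube d k).map '' ⋃ f ∈ {f : List ℕ+ | f.length = n},
        (cube (fun _ => d) f).rel A := by
  rw [iUnion_length_succ]
  simp only [cube_append_singleton, Cube.rel_relCube, image_iUnion]

theorem iUnion_cube_subset_unit (hE : E ⊆ baseSquare) (hdE : ∀ k, d k ∈ E) (n : ℕ) :
    ⋃ f ∈ {f : List ℕ+ | f.length = n}, (cube (fun _ => d) f).toSet ⊆ Cube.unit.toSet := by
  induction n with
  | zero => simp [cube]
  | succ n ih =>
    rw [iUnion_cube_succ]
    exact iUnion_subset fun k => (image_subset_blockCube ih k).trans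
      (blockCube_subset_unit (hE (hdE k)))

theorem stage_zero : stage (fun _ => E) (fun _ => d) 0 = blockWith E d Cube.unit.toSet := by
  rw [stage, Cube.unit_rel, blockWith_unit]

/-- The recursion, which refines the smallest cubes, agrees with a recursion at the top level. -/
theorem stage_succ (hE : E ⊆ baseSquare) (hdE : ∀ k, d k ∈ E) (n : ℕ) :
    stage (fun _ => E) (fun _ => d) (n + 1) = blockWith E d (stage (fun _ => E) (fun _ => d) n) ∧
      stage (fun _ => E) (fun _ => d) n ⊆ Cube.unit.toSet := by
  induction n with
  | zero =>
    refine ⟨?_, ?_⟩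
    · have h0 : (Cube.unit.toSet \ ⋃ f ∈ {f : List ℕ+ | f.length = 0},
          (cube (fun _ => d) f).toSet) ∪
          ⋃ f ∈ {f : List ℕ+ | f.length = 0}, (cube (fun _ => d) f).rel (block E d) =
          stage (fun _ => E) (fun _ => d) 0 := by
        simp [cube, stage]
      rw [stage.eq_2, iUnion_cube_succ, iUnion_rel_succ, stage_zero,
        blockWith_diff_union hE hdE Subset.rfl (iUnion_cube_subset_unit hE hdE 0), ← stage_zero, h0]
    · rw [stage_zero]
      exact blockWith_subset_unit hE hdE Subset.rfl
  | succ n ih =>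
    refine ⟨?_, ?_⟩
    · rw [stage, iUnion_cube_succ, iUnion_rel_succ, ih.1,
        blockWith_diff_union hE hdE ih.2 (iUnion_cube_subset_unit hE hdE (n + 1)), ← ih.1, stage]
    · rw [ih.1]
      exact blockWith_subset_unit hE hdE ih.2

theorem isClosed_stage (hE : E ⊆ baseSquare) (hcl : IsClosed E) (hdE : ∀ k, d k ∈ E) (n : ℕ) :
    IsClosed (stage (fun _ => E) (fun _ => d) n) := by
  induction n with
  | zero =>
    rw [stage_zero]
    exact isClosed_blockWith hcl hdE Subset.rfl Metric.isClosed_closedBall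
  | succ n ih =>
    rw [(stage_succ hE hdE n).1]
    exact isClosed_blockWith hcl hdE (stage_succ hE hdE n).2 ih

theorem limitSet_subset_unit (hE : E ⊆ baseSquare) (hdE : ∀ k, d k ∈ E) :
    limitSet (fun _ => E) (fun _ => d) ⊆ Cube.unit.toSet :=
  (iInter_subset _ 0).trans (stage_succ hE hdE 0).2

theorem isCompact_limitSet (hE : E ⊆ baseSquare) (hcl : IsClosed E) (hdE : ∀ k, d k ∈ E) :
    IsCompact (limitSet (fun _ => E) (fun _ => d)) :=
  (isCompact_closedBall Cube.unit.center Cube.unit.radius).of_isClosed_subset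
    (isClosed_iInter (isClosed_stage hE hcl hdE)) (limitSet_subset_unit hE hdE)

/-- Self-similarity of the limit set. -/
theorem blockWith_limitSet (hE : E ⊆ baseSquare) (hdE : ∀ k, d k ∈ E) :
    blockWith E d (limitSet (fun _ => E) (fun _ => d)) = limitSet (fun _ => E) (fun _ => d) := by
  have hstage := stage_succ hE hdE
  apply Subset.antisymm
  · refine subset_iInter fun n => ?_
    cases n with
    | zero =>
      rw [stage_zero]
      exact union_subset_union_right _ (iUnion_mono fun k =>
        image_mono (limitSet_subset_unit hE hdE))
    | succ n =>
      rw [(hstage n).1]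
      exact union_subset_union_right _ (iUnion_mono fun k => image_mono (iInter_subset _ n))
  · intro x hx
    have hx' := fun n => (hstage n).1 ▸ mem_iInter.1 hx (n + 1)
    rcases hx' 0 with h | h
    · exact Or.inl h
    · obtain ⟨k, y, hy, rfl⟩ := mem_iUnion.1 h
      refine Or.inr (mem_iUnion_of_mem k (mem_image_of_mem _ (mem_iInter.2 fun n => ?_)))
      exact (map_mem_blockWith_iff hE hdE (hstage n).2 ((hstage 0).2 hy)).1 (hx' n)

/-- Every point of the continuum is a limit of points `d k` with `k` arbitrarily large: unless the
continuum is a single point, it has no isolated points. -/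
theorem exists_large_index (hconn : IsPreconnected E) (hdE : ∀ k, d k ∈ E)
    (hdense : E ⊆ closure (range d)) {x : R3} (hx : x ∈ E) {ε : ℝ} (hε : 0 < ε) (N : ℕ) :
    ∃ k : ℕ+, N ≤ k ∧ dist (d k) x < ε := by
  rcases E.subsingleton_or_nontrivial with hs | hs
  · refine ⟨N.succPNat, Nat.le_succ N, ?_⟩
    rw [hs (hdE _) hx, dist_self]
    exact hε
  · have hfin : (d '' {k : ℕ+ | (k : ℕ) < N}).Finite :=
      ((finite_Iio N).preimage PNat.coe_injective.injOn).image d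
    -- The point `x` itself is kept: it may be among the excluded `d k`, but `y` below is not `x`.
    have hopen : IsOpen (Metric.ball x ε \ (d '' {k : ℕ+ | (k : ℕ) < N} \ {x})) :=
      Metric.isOpen_ball.sdiff hfin.sdiff.isClosed
    have hacc := hconn.preperfect_of_nontrivial hs x hx
    obtain ⟨y, ⟨hyU, hyE⟩, hyx⟩ := accPt_iff_nhds.1 hacc _
      (hopen.mem_nhds ⟨Metric.mem_ball_self hε, fun h => h.2 rfl⟩)
    obtain ⟨_, ⟨hzU, hzx⟩, k, rfl⟩ := mem_closure_iff.1 (hdense hyE) _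
      (hopen.sdiff (isClosed_singleton (x := x))) ⟨hyU, hyx⟩
    refine ⟨k, ?_, hzU.1⟩
    by_contra hlt
    exact hzU.2 ⟨⟨k, not_le.1 hlt, rfl⟩, hzx⟩

/-- The natural map of the limit set onto its part in the `n`-th cube of the first stage, counted
from `0`. -/
noncomputable def limitMap (hE : E ⊆ baseSquare) (hdE : ∀ k, d k ∈ E) (n : ℕ)
    (x : limitSet (fun _ => E) (fun _ => d)) : limitSet (fun _ => E) (fun _ => d) :=
  ⟨(blockCube d n.succPNat).map x, (blockWith_limitSet hE hdE).le
    (Or.inr (mem_iUnion_of_mem _ (mem_image_of_mem _ x.2)))⟩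

theorem mem_range_limitMap (hE : E ⊆ baseSquare) (hdE : ∀ k, d k ∈ E) {n : ℕ}
    {x : limitSet (fun _ => E) (fun _ => d)} :
    x ∈ range (limitMap hE hdE n) ↔ (x : R3) ∈ (blockCube d n.succPNat).toSet := by
  constructor
  · rintro ⟨y, rfl⟩
    exact map_mem_blockCube (limitSet_subset_unit hE hdE y.2) _
  · intro hx
    have hx' := (blockWith_limitSet hE hdE).ge x.2
    rcases hx' with h | h
    · exact absurd h (notMem_of_mem_blockCube hE hdE hx)
    · obtain ⟨k, y, hy, hyx⟩ := mem_iUnion.1 h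
      obtain rfl : k = n.succPNat := eq_of_mem_blockCube hE hdE
        (map_mem_blockCube (limitSet_subset_unit hE hdE hy) k) (hyx ▸ hx)
      exact ⟨⟨y, hy⟩, Subtype.ext hyx⟩

theorem mem_compl_iUnion_range_limitMap (hE : E ⊆ baseSquare) (hdE : ∀ k, d k ∈ E)
    {x : limitSet (fun _ => E) (fun _ => d)} :
    x ∈ (⋃ n, range (limitMap hE hdE n))ᶜ ↔ (x : R3) ∈ E := by
  simp only [mem_compl_iff, mem_iUnion, mem_range_limitMap, not_exists]
  constructor
  · intro h
    have hx' := (blockWith_limitSet hE hdE).ge x.2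
    refine hx'.resolve_right fun hx => ?_
    obtain ⟨k, hk⟩ := mem_iUnion.1 hx
    refine h k.natPred ?_
    rw [PNat.succPNat_natPred]
    exact image_subset_blockCube (limitSet_subset_unit hE hdE) k hk
  · exact fun h n hn => notMem_of_mem_blockCube hE hdE hn h

theorem dist_limitMap (hE : E ⊆ baseSquare) (hdE : ∀ k, d k ∈ E) (n : ℕ)
    (x y : limitSet (fun _ => E) (fun _ => d)) :
    dist (limitMap hE hdE n x) (limitMap hE hdE n y) = (1 / 4) ^ (n + 1) * dist x y := by
  change dist ((blockCube d n.succPNat).map x) ((blockCube d n.succPNat).map y) = _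
  rw [Cube.dist_map, two_mul_radius_blockCube]
  rfl

theorem isClopenSystem_limitMap (hE : E ⊆ baseSquare) (hcl : IsClosed E)
    (hconn : IsPreconnected E) (hdE : ∀ k, d k ∈ E) (hdense : E ⊆ closure (range d)) :
    IsClopenSystem (limitMap hE hdE) where
  injective n x y hxy :=
    Subtype.ext ((blockCube d n.succPNat).map_injective (congrArg Subtype.val hxy))
  dist_le_half n x y := by
    rw [dist_limitMap]
    have h1 : ((1 : ℝ) / 4) ^ (n + 1) ≤ 1 / 4 := pow_quarter_le n.succPNat
    have h2 := mul_le_mul_of_nonneg_right h1 (dist_nonneg (x := x) (y := y))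
    linarith [dist_nonneg (x := x) (y := y)]
  shrink ε hε := by
    obtain ⟨N, hN⟩ := exists_pow_lt_of_lt_one hε (by norm_num : (1 : ℝ) / 4 < 1)
    refine ⟨N, fun n hn x y => ?_⟩
    rw [dist_limitMap]
    have h1 : dist x y ≤ 1 := by
      have hx := Metric.mem_closedBall.1 (limitSet_subset_unit hE hdE x.2)
      have hy := Metric.mem_closedBall'.1 (limitSet_subset_unit hE hdE y.2)
      have hr : Cube.unit.radius = 1 / 2 := rfl
      have := dist_triangle (x : R3) Cube.unit.center y
      rw [Subtype.dist_eq]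
      linarith
    have h2 := pow_le_pow_of_le_one (by norm_num : (0 : ℝ) ≤ 1 / 4) (by norm_num)
      (Nat.le_succ_of_le hn)
    have h3 : (0 : ℝ) ≤ (1 / 4) ^ (n + 1) := by positivity
    calc ((1 : ℝ) / 4) ^ (n + 1) * dist x y ≤ (1 / 4) ^ (n + 1) * 1 :=
          mul_le_mul_of_nonneg_left h1 h3
      _ < ε := by rw [mul_one]; exact h2.trans_lt hN
  isOpen_range n := by
    -- Within the limit set, the complement of one cube is the union of `E` and the other parts.
    have hcomp := isCompact_limitSet hE hcl hdE
    let A : ℕ+ → Set R3 := fun k => if k = n.succPNat then ∅ else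
      (blockCube d k).map '' limitSet (fun _ => E) (fun _ => d)
    have hAsub : ∀ k, A k ⊆ (blockCube d k).map '' limitSet (fun _ => E) (fun _ => d) := by
      intro k
      by_cases hk : k = n.succPNat <;> simp [A, hk]
    have hA : IsClosed (E ∪ ⋃ k, A k) := by
      refine isClosed_union_iUnion hcl hdE (fun k => ?_) fun k => (hAsub k).trans
        (image_subset_blockCube (limitSet_subset_unit hE hdE) k)
      by_cases hk : k = n.succPNat
      · simp [A, hk]
      · simpa [A, hk] using (hcomp.image (blockCube d k).continuous_map).isClosed
    have heq : range (limitMap hE hdE n) = (Subtype.val ⁻¹' (E ∪ ⋃ k, A k))ᶜ := by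
      ext x
      rw [mem_range_limitMap, mem_compl_iff, mem_preimage]
      constructor
      · rintro hx (h | h)
        · exact notMem_of_mem_blockCube hE hdE hx h
        · obtain ⟨k, hk⟩ := mem_iUnion.1 h
          obtain rfl : k = n.succPNat := eq_of_mem_blockCube hE hdE
            (image_subset_blockCube (limitSet_subset_unit hE hdE) k (hAsub k hk)) hx
          simp [A] at hk
      · intro hx
        have hx' := (blockWith_limitSet hE hdE).ge x.2
        rcases hx' with h | h
        · exact absurd (Or.inl h) hx
        · obtain ⟨k, hk⟩ := mem_iUnion.1 h
          by_cases hkn : k = n.succPNat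
          · exact hkn ▸ image_subset_blockCube (limitSet_subset_unit hE hdE) k hk
          · refine absurd (Or.inr (mem_iUnion_of_mem k ?_)) hx
            simpa only [A, if_neg hkn] using hk
    rw [heq]
    exact (hA.preimage continuous_subtype_val).isOpen_compl
  disjoint m n hmn := disjoint_left.2 fun x hxm hxn => hmn (Nat.succPNat_injective
    (eq_of_mem_blockCube hE hdE ((mem_range_limitMap hE hdE).1 hxm)
      ((mem_range_limitMap hE hdE).1 hxn)))
  isPreconnected_core := by
    rw [← IsInducing.subtypeVal.isPreconnected_image]
    have heq : Subtype.val '' (⋃ n, range (limitMap hE hdE n))ᶜ = E := by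
      ext x
      constructor
      · rintro ⟨y, hy, rfl⟩
        exact (mem_compl_iUnion_range_limitMap hE hdE).1 hy
      · intro hx
        have hxL : x ∈ limitSet (fun _ => E) (fun _ => d) := by
          rw [← blockWith_limitSet hE hdE]
          exact Or.inl hx
        exact ⟨⟨x, hxL⟩, (mem_compl_iUnion_range_limitMap hE hdE).2 hx, rfl⟩
    rwa [heq]
  dense := by
    intro x
    by_cases hx : x ∈ ⋃ n, range (limitMap hE hdE n)
    · exact subset_closure hx
    have hxE : (x : R3) ∈ E := (mem_compl_iUnion_range_limitMap hE hdE).1 hx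
    refine Metric.mem_closure_iff.2 fun ε hε => ?_
    obtain ⟨N, hN⟩ := exists_pow_lt_of_lt_one (by linarith : 0 < ε / 4)
      (by norm_num : (1 : ℝ) / 4 < 1)
    obtain ⟨k, hNk, hk⟩ := exists_large_index hconn hdE hdense hxE (half_pos hε) N
    refine ⟨limitMap hE hdE k.natPred x, mem_iUnion_of_mem _ (mem_range_self x), ?_⟩
    have h1 := (mem_range_limitMap hE hdE).1 (mem_range_self (f := limitMap hE hdE k.natPred) x)
    rw [PNat.succPNat_natPred] at h1
    have h2 := dist_le_of_mem_blockCube h1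
    have h3 := pow_le_pow_of_le_one (by norm_num : (0 : ℝ) ≤ 1 / 4) (by norm_num) hNk
    have h4 := dist_triangle_right (x : R3) (limitMap hE hdE k.natPred x) (d k)
    rw [dist_comm (x : R3) (d k)] at h4
    rw [Subtype.dist_eq]
    linarith

end Stages

end Reconstr

theorem theorem6p7 (E : Set Reconstr.R3) (hE : E ⊆ Reconstr.baseSquare)
    (hcompact : IsCompact E) (hconn : IsConnected E)
    (d : ℕ+ → Reconstr.R3) (hdE : ∀ k, d k ∈ E) (hdense : E ⊆ closure (Set.range d)) :
    CompactSpace (Reconstr.limitSet (fun _ => E) (fun _ => d)) ∧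
    TopologicalSpace.MetrizableSpace (Reconstr.limitSet (fun _ => E) (fun _ => d)) ∧
    Reconstr.HHomogeneous (Reconstr.limitSet (fun _ => E) (fun _ => d)) ∧
    ¬ Reconstr.Reconstructible (Reconstr.limitSet (fun _ => E) (fun _ => d)) := by
  have hcomp : CompactSpace (Reconstr.limitSet (fun _ => E) (fun _ => d)) :=
    isCompact_iff_compactSpace.1 (Reconstr.isCompact_limitSet hE hcompact.isClosed hdE)
  have hsys := Reconstr.isClopenSystem_limitMap hE hcompact.isClosed hconn.isPreconnected hdE hdense
  have hne : Nonempty (Reconstr.limitSet (fun _ => E) (fun _ => d)) := by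
    obtain ⟨x, hx⟩ := hconn.nonempty
    refine ⟨⟨x, ?_⟩⟩
    rw [← Reconstr.blockWith_limitSet hE hdE]
    exact Or.inl hx
  exact ⟨hcomp, inferInstance, hsys.hHomogeneous, hsys.not_reconstructible⟩
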